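/- Let $n\in\mathbb{N}$, let $G\subsetneq\mathbb{R}^n$ be a domain (a non-empty, connected, open, proper subset), let $x,y\in G$ and $\lambda\in(0,1)$. Let $$s_G(x,y)=\sup_{z\in\partial G}\frac{|x-y|}{|x-z|+|z-y|}$$ be the triangular ratio metric and $$k_G(x,y)=\inf_{\gamma}\int_{\gamma}\frac{|dz|}{d(z,\partial G)}$$ the quasihyperbolic metric of $G$, where the infimum is taken over all rectifiable curves $\gamma$ joining $x$ to $y$ in $G$, $d(z,\partial G)$ is the Euclidean distance from $z$ to the boundary of $G$, and the integral is with respect to arc length. Then $$s_G(x,y)\le c\,\tanh\!\left(\frac{1+\lambda}{1-\lambda}\,k_G(x,y)\right),\qquad c=\frac{1}{\tanh\!\left(\frac{1+\lambda}{1-\lambda}\,\log(1+\lambda)\right)}.$$ -/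

import Mathlib

/-- The triangular ratio metric
`s_G(x,y) = sup_{z ∈ ∂G} |x - y| / (|x - z| + |z - y|)`. -/
noncomputable def triangularRatioMetric {n : ℕ} (G : Set (EuclideanSpace ℝ (Fin n)))
    (x y : EuclideanSpace ℝ (Fin n)) : ℝ :=
  ⨆ z : frontier G, dist x y / (dist x (z : EuclideanSpace ℝ (Fin n)) + dist (z : EuclideanSpace ℝ (Fin n)) y)

/-- `γ`, restricted to `[0, L]`, is a rectifiable curve of length `L` joining `x` to `y` in `G`,
parametrized by arc length: for `0 ≤ s ≤ t ≤ L` the length (total variation) of `γ` on `[s, t]`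
is `t - s`. -/
structure IsArcLengthCurve {n : ℕ} (G : Set (EuclideanSpace ℝ (Fin n)))
    (x y : EuclideanSpace ℝ (Fin n)) (L : ℝ) (γ : ℝ → EuclideanSpace ℝ (Fin n)) : Prop where
  length_nonneg : 0 ≤ L
  continuousOn : ContinuousOn γ (Set.Icc 0 L)
  unitSpeed : HasUnitSpeedOn γ (Set.Icc 0 L)
  source : γ 0 = x
  target : γ L = y
  mapsTo : Set.MapsTo γ (Set.Icc 0 L) G

/-- The quasihyperbolic metric `k_G(x,y) = inf_γ ∫_γ |dz| / d(z, ∂G)`, the infimum over all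
rectifiable curves `γ` joining `x` to `y` in `G`. The line integral with respect to arc length
is the ordinary integral over the arc length parameter. -/
noncomputable def quasihyperbolicMetric {n : ℕ} (G : Set (EuclideanSpace ℝ (Fin n)))
    (x y : EuclideanSpace ℝ (Fin n)) : ℝ :=
  sInf {I : ℝ | ∃ (L : ℝ) (γ : ℝ → EuclideanSpace ℝ (Fin n)), IsArcLengthCurve G x y L γ ∧
    I = ∫ t in (0 : ℝ)..L, 1 / Metric.infDist (γ t) (frontier G)}

/-! Put `t = |x - y| / min(d(x), d(y))`, where `d` is the distance to the boundary. Two estimates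
carry the proof: `k ≥ log (1 + t)`, since `d` is 1-Lipschitz along curves, and `s ≤ min(1, t/2)`.
Write `C = (1 + λ)/(1 - λ) ≥ 1`. If `k ≥ log (1 + λ)`, then `s ≤ 1` and monotonicity of `tanh`
suffice. Otherwise `t ≤ λ < 1`, and `t/2 ≤ tanh (log (1 + t)) ≤ tanh (C k)`, while the prefactor `c`
exceeds 1. Of `C` only `C ≥ 1` is used. -/

/-- An isometric parametrization has unit speed. -/
theorem Isometry.hasUnitSpeedOn {E : Type*} [PseudoEMetricSpace E] {f : ℝ → E} (hf : Isometry f)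
    (s : Set ℝ) : HasUnitSpeedOn f s := by
  intro a ha b hb
  have h : eVariationOn f (s ∩ Set.Icc a b) = eVariationOn id (s ∩ Set.Icc a b) := by
    simp only [eVariationOn, hf.edist_eq, id]
  rw [h, (monotone_id.monotoneOn s).eVariationOn_eq ha hb]
  simp

theorem HasUnitSpeedOn.dist_le {E : Type*} [PseudoMetricSpace E] {f : ℝ → E} {s : Set ℝ}
    (hf : HasUnitSpeedOn f s) {a b : ℝ} (ha : a ∈ s) (hb : b ∈ s) (hab : a ≤ b) :
    dist (f a) (f b) ≤ b - a := by
  have h := eVariationOn.edist_le f (s := s ∩ Set.Icc a b) ⟨ha, le_rfl, hab⟩ ⟨hb, hab, le_rfl⟩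
  rw [hf ha hb, edist_dist, NNReal.coe_one, one_mul] at h
  exact (ENNReal.ofReal_le_ofReal_iff (sub_nonneg.2 hab)).1 h

theorem HasUnitSpeedOn.congr {E : Type*} [PseudoEMetricSpace E] {f g : ℝ → E} {s : Set ℝ}
    (hf : HasUnitSpeedOn f s) (h : Set.EqOn f g s) : HasUnitSpeedOn g s := by
  intro a ha b hb
  rw [← hf ha hb]
  exact eVariationOn.congr fun t ht => (h ht.1).symm

theorem infDist_frontier_pos {X : Type*} [PseudoMetricSpace X] {G : Set X} {x : X}
    (hG : IsOpen G) (hf : (frontier G).Nonempty) (hx : x ∈ G) :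
    0 < Metric.infDist x (frontier G) :=
  (isClosed_frontier.notMem_iff_infDist_pos hf).1 fun h => by
    rw [hG.frontier_eq] at h
    exact h.2 hx

namespace IsArcLengthCurve

variable {n : ℕ} {G : Set (EuclideanSpace ℝ (Fin n))} {x y z : EuclideanSpace ℝ (Fin n)}
  {L : ℝ} {γ : ℝ → EuclideanSpace ℝ (Fin n)}

theorem const (hx : x ∈ G) : IsArcLengthCurve G x x 0 fun _ => x where
  length_nonneg := le_rfl
  continuousOn := continuousOn_const
  unitSpeed := hasConstantSpeedOnWith_of_subsingleton _ (by simp) _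
  source := rfl
  target := rfl
  mapsTo := fun _ _ => hx

/-- An arc length curve can be prolonged by a line segment contained in `G`. -/
theorem append_segment (h : IsArcLengthCurve G x y L γ) (hyz : segment ℝ y z ⊆ G) :
    ∃ (L' : ℝ) (γ' : ℝ → EuclideanSpace ℝ (Fin n)), IsArcLengthCurve G x z L' γ' := by
  rcases eq_or_ne y z with rfl | hne
  · exact ⟨L, γ, h⟩
  have hd : 0 < ‖z - y‖ := norm_pos_iff.2 (sub_ne_zero.2 hne.symm)
  let v := (‖z - y‖)⁻¹ • (z - y)
  have hv : ‖v‖ = 1 := by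
    simp [v, norm_smul, hd.ne']
  let σ : ℝ → EuclideanSpace ℝ (Fin n) := fun t => y + (t - L) • v
  have hσ : Isometry σ := by
    refine Isometry.of_dist_eq fun s t => ?_
    rw [dist_add_left, dist_eq_norm, ← sub_smul, norm_smul, hv, mul_one, sub_sub_sub_cancel_right,
      dist_eq_norm]
  have hL := h.length_nonneg
  have hγσ : γ L = σ L := by simp [σ, h.target]
  let γ' : ℝ → EuclideanSpace ℝ (Fin n) := fun t => if t ≤ L then γ t else σ t
  have h₁ : Set.EqOn γ γ' (Set.Icc 0 L) := fun t ht => by simp [γ', ht.2]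
  have h₂ : Set.EqOn σ γ' (Set.Icc L (L + ‖z - y‖)) := fun t ht => by
    rcases ht.1.eq_or_lt with rfl | hlt
    · simp [γ', hγσ]
    · simp [γ', hlt.not_ge]
  have hu : Set.Icc 0 L ∪ Set.Icc L (L + ‖z - y‖) = Set.Icc 0 (L + ‖z - y‖) :=
    Set.Icc_union_Icc_eq_Icc hL (by linarith)
  refine ⟨L + ‖z - y‖, γ', ⟨by linarith, ?_, ?_, ?_, ?_, ?_⟩⟩
  · rw [← hu]
    exact (h.continuousOn.congr h₁.symm).union_of_isClosed
      (hσ.continuous.continuousOn.congr h₂.symm) isClosed_Icc isClosed_Icc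
  · exact (h.unitSpeed.congr h₁).Icc_Icc ((hσ.hasUnitSpeedOn _).congr h₂)
  · rw [← h₁ ⟨le_rfl, hL⟩, h.source]
  · rw [← h₂ ⟨by linarith, le_rfl⟩]
    simp [σ, v, smul_smul, hd.ne']
  · rw [← hu]
    rintro t (ht | ht)
    · rw [← h₁ ht]
      exact h.mapsTo ht
    · rw [← h₂ ht]
      refine hyz ?_
      rw [segment_eq_image']
      refine ⟨(t - L) / ‖z - y‖, ⟨div_nonneg (by linarith [ht.1]) hd.le,
        (div_le_one hd).2 (by linarith [ht.2])⟩, ?_⟩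
      simp [σ, v, smul_smul, div_eq_mul_inv]

/-- Any two points of a domain are joined by a rectifiable curve. -/
theorem exists_of_isConnected (hG : IsOpen G) (hc : IsPreconnected G) (hx : x ∈ G) (hy : y ∈ G) :
    ∃ (L : ℝ) (γ : ℝ → EuclideanSpace ℝ (Fin n)), IsArcLengthCurve G x y L γ := by
  let U : Set (EuclideanSpace ℝ (Fin n)) :=
    {p | p ∈ G ∧ ∃ (L : ℝ) (γ : ℝ → EuclideanSpace ℝ (Fin n)), IsArcLengthCurve G x p L γ}
  have hU : IsOpen U := by
    refine Metric.isOpen_iff.2 fun p ⟨hp, L, γ, h⟩ => ?_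
    obtain ⟨r, hr, hb⟩ := Metric.isOpen_iff.1 hG p hp
    exact ⟨r, hr, fun q hq => ⟨hb hq, h.append_segment
      (((convex_ball p r).segment_subset (Metric.mem_ball_self hr) hq).trans hb)⟩⟩
  -- `U` is also relatively closed in `G`: a ball in `G` about a limit point contains a point of
  -- `U`, and a radius joins the two.
  have hcl : closure U ∩ G ⊆ U := by
    rintro p ⟨hpU, hp⟩
    obtain ⟨r, hr, hb⟩ := Metric.isOpen_iff.1 hG p hp
    obtain ⟨q, ⟨_, L, γ, h⟩, hq⟩ := Metric.mem_closure_iff.1 hpU r hr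
    exact ⟨hp, h.append_segment (((convex_ball p r).segment_subset
      (Metric.mem_ball'.2 hq) (Metric.mem_ball_self hr)).trans hb)⟩
  exact (hc.subset_of_closure_inter_subset hU ⟨x, hx, hx, 0, _, const hx⟩ hcl hy).2

theorem dist_le_length (h : IsArcLengthCurve G x y L γ) : dist x y ≤ L := by
  have hL := h.length_nonneg
  simpa [h.source, h.target] using h.unitSpeed.dist_le ⟨le_rfl, hL⟩ ⟨hL, le_rfl⟩ hL

theorem continuousOn_density (h : IsArcLengthCurve G x y L γ) (hG : IsOpen G)
    (hf : (frontier G).Nonempty) :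
    ContinuousOn (fun t => 1 / Metric.infDist (γ t) (frontier G)) (Set.Icc 0 L) :=
  continuousOn_const.div ((Metric.continuous_infDist_pt _).comp_continuousOn h.continuousOn)
    fun _ ht => (infDist_frontier_pos hG hf (h.mapsTo ht)).ne'

/-- After arc length `t` the boundary distance is at most `d + t`. Integrating `1 / (d + t)` over
`[0, L]` gives `log (1 + L / d)`, and `L` is at least `dist x y`. -/
theorem log_le_integral_source (h : IsArcLengthCurve G x y L γ) (hG : IsOpen G)
    (hf : (frontier G).Nonempty) :
    Real.log (1 + dist x y / Metric.infDist x (frontier G)) ≤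
      ∫ t in (0 : ℝ)..L, 1 / Metric.infDist (γ t) (frontier G) := by
  have hL := h.length_nonneg
  have hd : 0 < Metric.infDist x (frontier G) :=
    infDist_frontier_pos hG hf (h.source ▸ h.mapsTo ⟨le_rfl, hL⟩)
  set d := Metric.infDist x (frontier G)
  have hcont : ContinuousOn (fun t => 1 / (d + t)) (Set.Icc 0 L) :=
    continuousOn_const.div (by fun_prop) fun t ht => by linarith [ht.1]
  calc Real.log (1 + dist x y / d) ≤ Real.log ((d + L) / (d + 0)) := by
        refine Real.log_le_log (by positivity) ?_
        rw [add_zero, add_div, div_self hd.ne']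
        gcongr
        exact h.dist_le_length
    _ = ∫ t in (0 : ℝ)..L, 1 / (d + t) := by
        rw [intervalIntegral.integral_comp_add_left (fun t => 1 / t),
          integral_one_div_of_pos (by linarith) (by linarith)]
    _ ≤ _ := by
        refine intervalIntegral.integral_mono_on hL (hcont.intervalIntegrable_of_Icc hL)
          ((h.continuousOn_density hG hf).intervalIntegrable_of_Icc hL) fun t ht => ?_
        refine one_div_le_one_div_of_le (infDist_frontier_pos hG hf (h.mapsTo ht)) ?_
        have h₁ := h.unitSpeed.dist_le ⟨le_rfl, hL⟩ ht ht.1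
        rw [h.source, dist_comm, sub_zero] at h₁
        linarith [Metric.infDist_le_infDist_add_dist (s := frontier G) (x := γ t) (y := x)]

/-- The same estimate read backwards from `y`: the remaining length is `L - t`. -/
theorem log_le_integral_target (h : IsArcLengthCurve G x y L γ) (hG : IsOpen G)
    (hf : (frontier G).Nonempty) :
    Real.log (1 + dist x y / Metric.infDist y (frontier G)) ≤
      ∫ t in (0 : ℝ)..L, 1 / Metric.infDist (γ t) (frontier G) := by
  have hL := h.length_nonneg
  have hd : 0 < Metric.infDist y (frontier G) :=
    infDist_frontier_pos hG hf (h.target ▸ h.mapsTo ⟨hL, le_rfl⟩)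
  set d := Metric.infDist y (frontier G)
  have hcont : ContinuousOn (fun t => 1 / (d + L - t)) (Set.Icc 0 L) :=
    continuousOn_const.div (by fun_prop) fun t ht => by linarith [ht.2]
  calc Real.log (1 + dist x y / d) ≤ Real.log ((d + L - 0) / (d + L - L)) := by
        refine Real.log_le_log (by positivity) ?_
        rw [add_sub_cancel_right, sub_zero, add_div, div_self hd.ne']
        gcongr
        exact h.dist_le_length
    _ = ∫ t in (0 : ℝ)..L, 1 / (d + L - t) := by
        rw [intervalIntegral.integral_comp_sub_left (fun t => 1 / t),
          integral_one_div_of_pos (by linarith) (by linarith)]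
    _ ≤ _ := by
        refine intervalIntegral.integral_mono_on hL (hcont.intervalIntegrable_of_Icc hL)
          ((h.continuousOn_density hG hf).intervalIntegrable_of_Icc hL) fun t ht => ?_
        refine one_div_le_one_div_of_le (infDist_frontier_pos hG hf (h.mapsTo ht)) ?_
        have h₁ := h.unitSpeed.dist_le ht ⟨hL, le_rfl⟩ ht.2
        rw [h.target] at h₁
        linarith [Metric.infDist_le_infDist_add_dist (s := frontier G) (x := γ t) (y := y)]

end IsArcLengthCurve

/-- The quasihyperbolic metric dominates the distance ratio metric. -/
theorem log_le_quasihyperbolicMetric {n : ℕ} {G : Set (EuclideanSpace ℝ (Fin n))}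
    {x y : EuclideanSpace ℝ (Fin n)} (hG : IsOpen G) (hc : IsPreconnected G)
    (hf : (frontier G).Nonempty) (hx : x ∈ G) (hy : y ∈ G) :
    Real.log (1 + dist x y /
      min (Metric.infDist x (frontier G)) (Metric.infDist y (frontier G))) ≤
      quasihyperbolicMetric G x y := by
  -- A joining curve must exist: over an empty set `sInf` would be 0.
  obtain ⟨L, γ, h⟩ := IsArcLengthCurve.exists_of_isConnected hG hc hx hy
  refine le_csInf ⟨_, L, γ, h, rfl⟩ ?_
  rintro _ ⟨L', γ', h', rfl⟩
  rcases min_choice (Metric.infDist x (frontier G)) (Metric.infDist y (frontier G)) with hm | hm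
  · rw [hm]
    exact h'.log_le_integral_source hG hf
  · rw [hm]
    exact h'.log_le_integral_target hG hf

theorem triangularRatioMetric_le_one {n : ℕ} {G : Set (EuclideanSpace ℝ (Fin n))}
    (hf : (frontier G).Nonempty) (x y : EuclideanSpace ℝ (Fin n)) :
    triangularRatioMetric G x y ≤ 1 := by
  have := hf.to_subtype
  exact ciSup_le fun z => div_le_one_of_le₀ (dist_triangle _ _ _) (by positivity)

/-- Each of the two summands in the denominator is at least the smaller boundary distance. -/
theorem triangularRatioMetric_le_half {n : ℕ} {G : Set (EuclideanSpace ℝ (Fin n))}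
    {x y : EuclideanSpace ℝ (Fin n)} (hG : IsOpen G) (hf : (frontier G).Nonempty)
    (hx : x ∈ G) (hy : y ∈ G) :
    triangularRatioMetric G x y ≤ dist x y /
      min (Metric.infDist x (frontier G)) (Metric.infDist y (frontier G)) / 2 := by
  have := hf.to_subtype
  refine ciSup_le fun z => ?_
  have hm := lt_min (infDist_frontier_pos hG hf hx) (infDist_frontier_pos hG hf hy)
  rw [div_div]
  refine div_le_div_of_nonneg_left dist_nonneg (by positivity) ?_
  have h₁ := Metric.infDist_le_dist_of_mem (x := x) z.2
  have h₂ := Metric.infDist_le_dist_of_mem (x := y) z.2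
  rw [dist_comm y] at h₂
  linarith [min_le_left (Metric.infDist x (frontier G)) (Metric.infDist y (frontier G)),
    min_le_right (Metric.infDist x (frontier G)) (Metric.infDist y (frontier G))]

theorem Real.monotone_tanh : Monotone Real.tanh := by
  intro a b hab
  rw [Real.tanh_eq_sinh_div_cosh, Real.tanh_eq_sinh_div_cosh,
    div_le_div_iff₀ (Real.cosh_pos a) (Real.cosh_pos b)]
  have h : 0 ≤ Real.sinh (b - a) := Real.sinh_nonneg_iff.2 (sub_nonneg.2 hab)
  rw [Real.sinh_sub] at h
  linarith

theorem Real.tanh_pos_of_pos {a : ℝ} (ha : 0 < a) : 0 < Real.tanh a := by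
  rw [Real.tanh_eq_sinh_div_cosh]
  exact div_pos (Real.sinh_pos_iff.2 ha) (Real.cosh_pos a)

theorem Real.half_le_tanh_log_one_add {t : ℝ} (h₀ : 0 ≤ t) (h₁ : t ≤ 1) :
    t / 2 ≤ Real.tanh (Real.log (1 + t)) := by
  have h : (0 : ℝ) < 1 + t := by linarith
  rw [Real.tanh_eq_sinh_div_cosh, le_div_iff₀ (Real.cosh_pos _), Real.sinh_log h, Real.cosh_log h]
  rw [inv_eq_one_div, ← sub_nonneg]
  -- This is `sinh - (t / 2) * cosh` at `log (1 + t)`; its sign is that of `2 - t ^ 2` when `t > 0`.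
  have : (1 + t - 1 / (1 + t)) / 2 - t / 2 * ((1 + t + 1 / (1 + t)) / 2) =
      t * (2 - t ^ 2) / (4 * (1 + t)) := by
    field_simp
    ring
  rw [this]
  have : 0 ≤ 2 - t ^ 2 := by nlinarith
  positivity

theorem mainTheorem12 (n : ℕ) (G : Set (EuclideanSpace ℝ (Fin n)))
    (hG_open : IsOpen G) (hG_conn : IsConnected G) (hG_proper : G ≠ Set.univ)
    (x y : EuclideanSpace ℝ (Fin n)) (hx : x ∈ G) (hy : y ∈ G)
    (lam : ℝ) (hlam : lam ∈ Set.Ioo (0 : ℝ) 1) :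
    triangularRatioMetric G x y ≤
      (1 / Real.tanh ((1 + lam) / (1 - lam) * Real.log (1 + lam))) *
        Real.tanh ((1 + lam) / (1 - lam) * quasihyperbolicMetric G x y) := by
  obtain ⟨h₀, h₁⟩ := hlam
  have hf : (frontier G).Nonempty := nonempty_frontier_iff.2 ⟨hG_conn.nonempty, hG_proper⟩
  have hC : 1 ≤ (1 + lam) / (1 - lam) := (one_le_div (by linarith)).2 (by linarith)
  have hlog : 0 < Real.log (1 + lam) := Real.log_pos (by linarith)
  have hT := Real.tanh_pos_of_pos (mul_pos (zero_lt_one.trans_le hC) hlog)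
  have hk := log_le_quasihyperbolicMetric hG_open hG_conn.isPreconnected hf hx hy
  have hs := triangularRatioMetric_le_half hG_open hf hx hy
  have ht : 0 ≤ dist x y / min (Metric.infDist x (frontier G)) (Metric.infDist y (frontier G)) :=
    div_nonneg dist_nonneg (le_min Metric.infDist_nonneg Metric.infDist_nonneg)
  set t := dist x y / min (Metric.infDist x (frontier G)) (Metric.infDist y (frontier G))
  set k := quasihyperbolicMetric G x y
  set C := (1 + lam) / (1 - lam)
  rw [one_div_mul_eq_div, le_div_iff₀ hT]
  rcases le_total (Real.log (1 + lam)) k with h | h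
  · calc triangularRatioMetric G x y * Real.tanh (C * Real.log (1 + lam))
        ≤ 1 * Real.tanh (C * Real.log (1 + lam)) := by
          gcongr
          exact triangularRatioMetric_le_one hf x y
      _ ≤ Real.tanh (C * k) := by
          rw [one_mul]
          exact Real.monotone_tanh (by gcongr)
  -- Here `log (1 + t) ≤ k ≤ log (1 + lam)`, so `t ≤ lam`.
  · have htl : t ≤ 1 := by
      have := (Real.log_le_log_iff (by linarith) (by linarith)).1 (hk.trans h)
      linarith
    have hk₀ : 0 ≤ k := (Real.log_nonneg (by linarith)).trans hk
    calc triangularRatioMetric G x y * Real.tanh (C * Real.log (1 + lam))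
        ≤ t / 2 * Real.tanh (C * Real.log (1 + lam)) := by gcongr
      _ ≤ t / 2 * 1 := by
          gcongr
          exact (Real.tanh_lt_one _).le
      _ ≤ Real.tanh (Real.log (1 + t)) := by
          rw [mul_one]
          exact Real.half_le_tanh_log_one_add ht htl
      _ ≤ Real.tanh (C * k) := Real.monotone_tanh (hk.trans (le_mul_of_one_le_left hk₀ hC))
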